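/- Let $k$ be a field of characteristic $0$, $R$ a commutative $k$-algebra, $P$ a finitely generated projective $R$-module, $P^\vee=\mathrm{Hom}_R(P,R)$, and $S=\mathrm{Sym}_R(P^\vee)$. Consider $R$ as an $S$-algebra through the zero section $S\to R$, $P^\vee\mapsto 0$. The fancy Koszul cdga $\mathrm{K}(R;P)$ is the non-positively graded commutative differential graded $S$-algebra $S\otimes_R\bigwedge^\bullet P^\vee$, with $S\otimes_R\bigwedge^{n}P^\vee$ in cohomological degree $-n$ and with the $S$-linear differential $$d\bigl(a\otimes(\beta_1\wedge\dots\wedge\beta_{n})\bigr)=\sum_j a\,\alpha_j\otimes\sum_{i=1}^{n}(-1)^{i}\beta_i(x_j)\,\beta_1\wedge\dots\wedge\check{\beta_i}\wedge\dots\wedge\beta_{n},$$ where $\sum_j\alpha_j\otimes x_j\in P^\vee\otimes_R P$ corresponds to $\mathrm{id}_P$ under $P^\vee\otimes_R P\simeq\mathrm{Hom}_R(P,P)$. Let $\mathbf{cdga}_S$ be the category of non-positively graded cdga's over $S$, with its standard model structure: weak equivalences are the quasi-isomorphisms, fibrations are the morphisms that are surjective in all degrees $<0$, and cofibrations are the morphisms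 with the left lifting property with respect to the fibrations that are weak equivalences. Then the augmentation $\mathrm{K}(R;P)\to S\to R$ is a cofibrant resolution of $R$ in $\mathbf{cdga}_S$: $\mathrm{K}(R;P)$ is a cofibrant object, and the augmentation is a weak equivalence and a fibration. In particular $H^m(\mathrm{K}(R;P))=0$ for $m<0$, and $H^0(\mathrm{K}(R;P))\simeq R$ as $S$-modules. -/

import Mathlib

open CategoryTheory CategoryTheory.Limits HomotopicalAlgebra
open scoped TensorProduct

universe u v

/-! ### Non-positively graded commutative dg algebras -/

/-- A non-positively graded commutative differential graded algebra over a commutative ring `S`.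
The grading is written homologically: `deg n` is the component of cohomological degree `-n`, so
that the differential, which raises the cohomological degree by `1`, maps `deg (n + 1)` into
`deg n` and vanishes on `deg 0`. -/
structure CDGA (S : Type u) [CommRing S] where
  /-- the direct sum of all the graded components -/
  carrier : Type u
  [ring : Ring carrier]
  [algebra : Algebra S carrier]
  /-- `deg n` is the component of cohomological degree `-n` -/
  deg : ℕ → Submodule S carrier
  [graded : GradedAlgebra deg]
  /-- the differential -/
  d : carrier →ₗ[S] carrier
  d_mem : ∀ {n : ℕ} {a : carrier}, a ∈ deg (n + 1) → d a ∈ deg n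
  d_zero : ∀ {a : carrier}, a ∈ deg 0 → d a = 0
  d_d : ∀ a : carrier, d (d a) = 0
  leibniz : ∀ {m : ℕ} {a : carrier} (b : carrier), a ∈ deg m →
    d (a * b) = d a * b + (-1) ^ m * (a * d b)
  graded_comm : ∀ {m n : ℕ} {a b : carrier}, a ∈ deg m → b ∈ deg n →
    a * b = (-1) ^ (m * n) * (b * a)

namespace CDGA

attribute [instance] CDGA.ring CDGA.algebra CDGA.graded

variable {S : Type u} [CommRing S]

/-- A morphism of cdga's over `S`: a morphism of `S`-algebras which preserves the degrees and
commutes with the differentials. -/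
@[ext]
structure Hom (A B : CDGA S) where
  toAlgHom : A.carrier →ₐ[S] B.carrier
  map_deg : ∀ {n : ℕ} {a : A.carrier}, a ∈ A.deg n → toAlgHom a ∈ B.deg n
  map_d : ∀ a : A.carrier, toAlgHom (A.d a) = B.d (toAlgHom a)

instance : Category (CDGA S) where
  Hom A B := Hom A B
  id A :=
    { toAlgHom := AlgHom.id S A.carrier
      map_deg := fun h => h
      map_d := fun _ => rfl }
  comp f g :=
    { toAlgHom := g.toAlgHom.comp f.toAlgHom
      map_deg := fun h => g.map_deg (f.map_deg h)
      map_d := fun a => by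
        rw [AlgHom.comp_apply, AlgHom.comp_apply, f.map_d, g.map_d] }

/-- The differential `deg (n + 1) → deg n`. -/
def dRestrict (A : CDGA S) (n : ℕ) : A.deg (n + 1) →ₗ[S] A.deg n :=
  A.d.restrict fun _ h => A.d_mem h

/-- The component in degree `n` of a morphism of cdga's. -/
def Hom.restrict {A B : CDGA S} (f : Hom A B) (n : ℕ) : A.deg n →ₗ[S] B.deg n :=
  f.toAlgHom.toLinearMap.restrict fun _ h => f.map_deg h

lemma dRestrict_comp (A : CDGA S) (n : ℕ) :
    ModuleCat.ofHom (A.dRestrict (n + 1)) ≫ ModuleCat.ofHom (A.dRestrict n) = 0 := by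
  refine ModuleCat.hom_ext (LinearMap.ext fun x => Subtype.ext ?_)
  exact A.d_d x.1

lemma Hom.restrict_comp {A B : CDGA S} (f : Hom A B) (n : ℕ) :
    ModuleCat.ofHom (Hom.restrict f (n + 1)) ≫ ModuleCat.ofHom (B.dRestrict n) =
      ModuleCat.ofHom (A.dRestrict n) ≫ ModuleCat.ofHom (Hom.restrict f n) := by
  refine ModuleCat.hom_ext (LinearMap.ext fun x => Subtype.ext ?_)
  exact (f.map_d x.1).symm

/-- The complex of `S`-modules underlying a cdga. Its homology in degree `n` is the cohomology of
the cdga in degree `-n`. -/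
noncomputable def toComplex (S : Type u) [CommRing S] :
    CDGA S ⥤ ChainComplex (ModuleCat.{u} S) ℕ where
  obj A := ChainComplex.of (fun n => ModuleCat.of S (A.deg n))
    (fun n => ModuleCat.ofHom (A.dRestrict n)) A.dRestrict_comp
  map {A B} f := ChainComplex.ofHom (fun n => ModuleCat.ofHom (Hom.restrict f n)) (fun n => by
    dsimp only [ChainComplex.of]
    rw [ChainComplex.of_d, ChainComplex.of_d]
    exact Hom.restrict_comp f n)
  map_id A := by
    ext n x
    rfl
  map_comp f g := by
    ext n x
    rfl

/-! ### Weak equivalences, fibrations and cofibrations -/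

/-- The weak equivalences of cdga's are the quasi-isomorphisms. -/
instance : CategoryWithWeakEquivalences (CDGA S) where
  weakEquivalences := fun _ _ f => QuasiIso ((toComplex S).map f)

/-- The fibrations of cdga's are the morphisms which are surjective in every negative cohomological
degree. -/
instance : CategoryWithFibrations (CDGA S) where
  fibrations := fun _ _ f => ∀ n : ℕ, 0 < n → Function.Surjective (Hom.restrict f n)

/-- The cofibrations of cdga's are the morphisms which have the left lifting property with respect
to all the morphisms that are both fibrations and weak equivalences. -/
instance : CategoryWithCofibrations (CDGA S) where
  cofibrations := (trivialFibrations (CDGA S)).llp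

/-! ### Algebras as cdga's concentrated in degree zero -/

/-- The trivial grading, concentrated in degree `0`. -/
def trivialDeg (S B : Type u) [CommRing S] [CommRing B] [Algebra S B] (n : ℕ) : Submodule S B :=
  if n = 0 then ⊤ else ⊥

lemma trivialDeg_zero (S B : Type u) [CommRing S] [CommRing B] [Algebra S B] (b : B) :
    b ∈ trivialDeg S B 0 := by
  simp [trivialDeg]

lemma eq_zero_of_mem_trivialDeg {S B : Type u} [CommRing S] [CommRing B] [Algebra S B] {n : ℕ}
    {b : B} (hn : n ≠ 0) (hb : b ∈ trivialDeg S B n) : b = 0 := by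
  simpa [trivialDeg, hn] using hb

instance trivialDeg.gradedAlgebra (S B : Type u) [CommRing S] [CommRing B] [Algebra S B] :
    GradedAlgebra (trivialDeg S B) where
  one_mem := trivialDeg_zero S B 1
  mul_mem := by
    intro i j a b ha hb
    by_cases hi : i = 0
    · by_cases hj : j = 0
      · subst hi hj
        exact trivialDeg_zero S B _
      · rw [eq_zero_of_mem_trivialDeg hj hb, mul_zero]
        exact zero_mem _
    · rw [eq_zero_of_mem_trivialDeg hi ha, zero_mul]
      exact zero_mem _
  decompose' b := DirectSum.of (fun n => trivialDeg S B n) 0 ⟨b, trivialDeg_zero S B b⟩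
  left_inv b := by simp
  right_inv x := by
    induction x using DirectSum.induction_on with
    | zero =>
      rw [map_zero]
      exact map_zero (DirectSum.of (fun n => trivialDeg S B n) 0)
    | of i x =>
      obtain ⟨x, hx⟩ := x
      by_cases hi : i = 0
      · subst hi
        simp
      · obtain rfl := eq_zero_of_mem_trivialDeg hi hx
        have h0 : (⟨0, hx⟩ : trivialDeg S B i) = 0 := rfl
        rw [h0, map_zero, map_zero]
        exact map_zero (DirectSum.of (fun n => trivialDeg S B n) 0)
    | add x y hx hy =>
      rw [map_add]
      refine Eq.trans ?_ (congrArg₂ (· + ·) hx hy)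
      exact map_add (DirectSum.of (fun n => trivialDeg S B n) 0) ⟨_, trivialDeg_zero S B _⟩
        ⟨_, trivialDeg_zero S B _⟩

/-- A commutative `S`-algebra, viewed as a cdga over `S` concentrated in degree `0`. -/
def ofAlgebra (S B : Type u) [CommRing S] [CommRing B] [Algebra S B] : CDGA S where
  carrier := B
  deg := trivialDeg S B
  d := 0
  d_mem := fun _ => zero_mem _
  d_zero := fun _ => rfl
  d_d := fun _ => rfl
  leibniz := fun b _ => by simp
  graded_comm := by
    intro m n a b ha hb
    by_cases hm : m = 0
    · subst hm
      simp [mul_comm]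
    · rw [eq_zero_of_mem_trivialDeg hm ha]
      simp

/-- A morphism out of the base ring `S`. -/
def fromBase (A : CDGA S) : ofAlgebra S S ⟶ A :=
  Hom.mk (A := ofAlgebra S S) (Algebra.ofId S A.carrier)
    (by
      intro n a ha
      by_cases hn : n = 0
      · subst hn
        exact SetLike.algebraMap_mem_graded A.deg a
      · obtain rfl : a = 0 := eq_zero_of_mem_trivialDeg (B := S) hn ha
        have h : Algebra.ofId S A.carrier 0 ∈ A.deg n := by
          rw [map_zero]
          exact zero_mem _
        exact h)
    (by
      intro a
      exact (map_zero (Algebra.ofId S A.carrier)).trans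
        (A.d_zero (SetLike.algebraMap_mem_graded A.deg a)).symm)

/-- The base ring `S`, concentrated in degree `0`, is the initial cdga over `S`. -/
def isInitialBase : IsInitial (ofAlgebra S S) :=
  IsInitial.ofUniqueHom fromBase (fun A f => by
    apply Hom.ext
    exact Subsingleton.elim (α := S →ₐ[S] A.carrier) f.toAlgHom (fromBase A).toAlgHom)

instance : HasInitial (CDGA S) := isInitialBase.hasInitial

end CDGA

/-! ### The fancy Koszul cdga -/

namespace FancyKoszul

section Exterior

variable {R M : Type*} [CommRing R] [AddCommGroup M] [Module R M]

open ExteriorAlgebra in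
lemma ι_mul_comm (x : M) {n : ℕ} {b : ExteriorAlgebra R M} (hb : b ∈ ⋀[R]^n M) :
    ι R x * b = (-1) ^ n * (b * ι R x) := by
  induction hb using Submodule.pow_induction_on_left' with
  | algebraMap r => simp [Algebra.commutes]
  | add _ _ _ _ _ ihx ihy => rw [mul_add, ihx, ihy, add_mul, mul_add]
  | mem_mul m hm i y _ ih =>
    obtain ⟨z, rfl⟩ := hm
    have h := eq_neg_of_add_eq_zero_left (ι_add_mul_swap (R := R) x z)
    rw [← mul_assoc, h, neg_mul, mul_assoc, ih, pow_succ]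
    have hc : ι R z * (-1) ^ i = (-1) ^ i * ι R z := ((Commute.neg_one_right _).pow_right i).eq
    rw [← mul_assoc (ι R z), hc]
    simp [mul_assoc]

lemma graded_comm {m n : ℕ} {a b : ExteriorAlgebra R M} (ha : a ∈ ⋀[R]^m M)
    (hb : b ∈ ⋀[R]^n M) : a * b = (-1) ^ (m * n) * (b * a) := by
  induction ha using Submodule.pow_induction_on_left' with
  | algebraMap r => simp [Algebra.commutes]
  | add _ _ _ _ _ ihx ihy => rw [add_mul, ihx, ihy, mul_add, mul_add]
  | mem_mul x hx i y _ ih =>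
    obtain ⟨z, rfl⟩ := hx
    have hc : ExteriorAlgebra.ι R z * (-1) ^ (i * n) = (-1) ^ (i * n) * ExteriorAlgebra.ι R z :=
      ((Commute.neg_one_right _).pow_right _).eq
    rw [mul_assoc, ih, ← mul_assoc, hc, mul_assoc, ← mul_assoc _ b, ι_mul_comm z hb, Nat.succ_mul,
      pow_add]
    simp only [mul_assoc]

/-- Contraction of an exterior form by a linear form on the generators,
`β₁ ∧ ⋯ ∧ βₙ ↦ ∑ₖ (-1)ᵏ⁻¹ f(βₖ) β₁ ∧ ⋯ ∧ β̌ₖ ∧ ⋯ ∧ βₙ`. -/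
noncomputable def contract (f : Module.Dual R M) : ExteriorAlgebra R M →ₗ[R] ExteriorAlgebra R M :=
  CliffordAlgebra.contractLeft (Q := (0 : QuadraticForm R M)) f

lemma contract_leibniz (f : Module.Dual R M) {m : ℕ} {a : ExteriorAlgebra R M}
    (b : ExteriorAlgebra R M) (ha : a ∈ ⋀[R]^m M) :
    contract f (a * b) = contract f a * b + (-1) ^ m * (a * contract f b) := by
  induction ha using Submodule.pow_induction_on_left' with
  | algebraMap r =>
    simp only [contract, CliffordAlgebra.contractLeft_algebraMap_mul,
      CliffordAlgebra.contractLeft_algebraMap, zero_mul, zero_add, pow_zero, one_mul]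
  | add _ _ _ _ _ ihx ihy =>
    rw [add_mul, map_add, ihx, ihy, map_add, add_mul, add_mul, mul_add]
    abel
  | mem_mul x hx i y _ ih =>
    obtain ⟨z, rfl⟩ := hx
    have h (w : ExteriorAlgebra R M) : contract f (ExteriorAlgebra.ι R z * w) =
        f z • w - ExteriorAlgebra.ι R z * contract f w :=
      CliffordAlgebra.contractLeft_ι_mul f z w
    have hc : ExteriorAlgebra.ι R z * (-1) ^ i = (-1) ^ i * ExteriorAlgebra.ι R z :=
      ((Commute.neg_one_right _).pow_right _).eq
    rw [mul_assoc, h, ih, h, mul_add, ← mul_assoc _ ((-1) ^ i), hc, sub_mul, pow_succ,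
      smul_mul_assoc]
    simp only [mul_assoc, neg_mul, one_mul, mul_neg]
    abel

lemma contract_mem (f : Module.Dual R M) {m : ℕ} {a : ExteriorAlgebra R M}
    (ha : a ∈ ⋀[R]^(m + 1) M) : contract f a ∈ ⋀[R]^m M := by
  induction m generalizing a with
  | zero =>
    rw [zero_add, ExteriorAlgebra.exteriorPower, pow_one] at ha
    obtain ⟨z, rfl⟩ := ha
    rw [contract, ExteriorAlgebra.ι, CliffordAlgebra.contractLeft_ι]
    exact SetLike.algebraMap_mem_graded (fun n => ⋀[R]^n M) (f z)
  | succ m ih =>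
    rw [ExteriorAlgebra.exteriorPower, pow_succ'] at ha
    induction ha using Submodule.mul_induction_on' with
    | mem_mul_mem x hx y hy =>
      obtain ⟨z, rfl⟩ := hx
      have h : contract f (ExteriorAlgebra.ι R z * y) =
          f z • y - ExteriorAlgebra.ι R z * contract f y :=
        CliffordAlgebra.contractLeft_ι_mul f z y
      rw [h]
      refine sub_mem (Submodule.smul_mem _ _ hy) ?_
      rw [ExteriorAlgebra.exteriorPower, pow_succ']
      exact Submodule.mul_mem_mul ⟨z, rfl⟩ (ih hy)
    | add x _ y _ hx hy =>
      rw [map_add]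
      exact add_mem hx hy

lemma contract_of_mem_zero (f : Module.Dual R M) {a : ExteriorAlgebra R M}
    (ha : a ∈ ⋀[R]^0 M) : contract f a = 0 := by
  rw [ExteriorAlgebra.exteriorPower, pow_zero] at ha
  obtain ⟨r, rfl⟩ := Submodule.mem_one.1 ha
  exact CliffordAlgebra.contractLeft_algebraMap (Q := (0 : QuadraticForm R M)) f r

end Exterior

variable (R P : Type u) [CommRing R] [AddCommGroup P] [Module R P]

/-- The symmetric algebra `S = Sym_R(P^∨)`. -/
abbrev SymDual : Type u := SymmetricAlgebra R (Module.Dual R P)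

/-- The exterior algebra `⋀ P^∨`. -/
abbrev ExtDual : Type u := ExteriorAlgebra R (Module.Dual R P)

/-- The algebra `S ⊗_R ⋀ P^∨`. -/
abbrev KoszulAlg : Type u := SymDual R P ⊗[R] ExtDual R P

/-- The component `S ⊗_R ⋀ⁿ P^∨` of cohomological degree `-n`. -/
abbrev deg (n : ℕ) : Submodule (SymDual R P) (KoszulAlg R P) :=
  (⋀[R]^n (Module.Dual R P)).baseChange (SymDual R P)

variable {R P} in
lemma deg_eq_span (n : ℕ) : deg R P n = Submodule.span (SymDual R P)
    (TensorProduct.mk R (SymDual R P) (ExtDual R P) 1 '' (⋀[R]^n (Module.Dual R P))) :=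
  Submodule.baseChange_eq_span _ _

/-- The operator `a ⊗ ω ↦ a α ⊗ (x ⌟ ω)` for `α` in `P^∨` and `x` in `P`. -/
noncomputable def op (α : Module.Dual R P) (x : P) : KoszulAlg R P →ₗ[SymDual R P] KoszulAlg R P :=
  SymmetricAlgebra.ι R (Module.Dual R P) α •
    (contract (Module.Dual.eval R P x)).baseChange (SymDual R P)

variable {R P}

lemma op_tmul (α : Module.Dual R P) (x : P) (a : SymDual R P) (w : ExtDual R P) :
    op R P α x (a ⊗ₜ w) =
      (a * SymmetricAlgebra.ι R _ α) ⊗ₜ contract (Module.Dual.eval R P x) w := by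
  rw [op, LinearMap.smul_apply, LinearMap.baseChange_tmul, TensorProduct.smul_tmul', smul_eq_mul,
    mul_comm]

lemma contract_add (f g : Module.Dual R (Module.Dual R P)) :
    contract (f + g) = contract f + contract g := by
  simp only [contract, map_add]

lemma contract_smul (r : R) (f : Module.Dual R (Module.Dual R P)) :
    contract (r • f) = r • contract f := by
  simp only [contract, map_smul]

variable (R P) in
/-- The map `P^∨ ⊗ P → End_S(S ⊗ ⋀ P^∨)` sending `α ⊗ x` to the operator
`a ⊗ ω ↦ a α ⊗ (x ⌟ ω)`. -/
noncomputable def opTensor :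
    Module.Dual R P ⊗[R] P →ₗ[R] (KoszulAlg R P →ₗ[SymDual R P] KoszulAlg R P) :=
  TensorProduct.lift (LinearMap.mk₂ R (op R P)
    (fun α β x => by
      ext w
      simp [op_tmul, mul_add, TensorProduct.add_tmul])
    (fun r α x => by
      ext w
      simp [op_tmul, TensorProduct.smul_tmul'])
    (fun α x y => by
      ext w
      simp [op_tmul, contract_add, TensorProduct.tmul_add])
    (fun r α x => by
      ext w
      simp [op_tmul, contract_smul]))

variable (R) in
lemma opTensor_tmul (α : Module.Dual R P) (x : P) : opTensor R P (α ⊗ₜ x) = op R P α x := rfl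

lemma opTensor_mem (t : Module.Dual R P ⊗[R] P) {n : ℕ} {a : KoszulAlg R P} (ha : a ∈ deg R P (n + 1)) :
    opTensor R P t a ∈ deg R P n := by
  induction t with
  | zero => simp
  | add t t' ht ht' =>
    rw [map_add, LinearMap.add_apply]
    exact add_mem ht ht'
  | tmul α x =>
    rw [deg_eq_span] at ha
    induction ha using Submodule.span_induction with
    | zero => simp
    | add a b _ _ ha hb =>
      rw [map_add]
      exact add_mem ha hb
    | smul c a _ ha =>
      rw [map_smul]
      exact Submodule.smul_mem _ _ ha
    | mem a ha =>
      obtain ⟨w, hw, rfl⟩ := ha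
      rw [TensorProduct.mk_apply, opTensor_tmul, op_tmul]
      exact Submodule.tmul_mem_baseChange_of_mem _ (contract_mem _ hw)

lemma opTensor_of_mem_zero (t : Module.Dual R P ⊗[R] P) {a : KoszulAlg R P} (ha : a ∈ deg R P 0) :
    opTensor R P t a = 0 := by
  induction t with
  | zero => simp
  | add t t' ht ht' => rw [map_add, LinearMap.add_apply, ht, ht', add_zero]
  | tmul α x =>
    rw [deg_eq_span] at ha
    induction ha using Submodule.span_induction with
    | zero => simp
    | add a b _ _ ha hb => rw [map_add, ha, hb, add_zero]
    | smul c a _ ha => rw [map_smul, ha, smul_zero]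
    | mem a ha =>
      obtain ⟨w, hw, rfl⟩ := ha
      rw [TensorProduct.mk_apply, opTensor_tmul, op_tmul, contract_of_mem_zero _ hw,
        TensorProduct.tmul_zero]

lemma op_op (α β : Module.Dual R P) (x y : P) (a : KoszulAlg R P) :
    op R P α x (op R P β y a) = - op R P β y (op R P α x a) := by
  induction a using TensorProduct.induction_on with
  | zero => simp
  | add a b ha hb => simp only [map_add, ha, hb, neg_add]
  | tmul a w =>
    rw [op_tmul, op_tmul, op_tmul, op_tmul, mul_right_comm, ← TensorProduct.tmul_neg]
    exact congrArg _ (CliffordAlgebra.contractLeft_comm (Q := (0 : QuadraticForm R _)) _ _ w)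

lemma op_op_self (α : Module.Dual R P) (x : P) (a : KoszulAlg R P) :
    op R P α x (op R P α x a) = 0 := by
  induction a using TensorProduct.induction_on with
  | zero => simp
  | add a b ha hb => simp only [map_add, ha, hb, add_zero]
  | tmul a w =>
    have h : contract (Module.Dual.eval R P x) (contract (Module.Dual.eval R P x) w) = 0 :=
      CliffordAlgebra.contractLeft_contractLeft (Q := (0 : QuadraticForm R _)) _ w
    rw [op_tmul, op_tmul, h, TensorProduct.tmul_zero]

lemma opTensor_opTensor (t t' : Module.Dual R P ⊗[R] P) (a : KoszulAlg R P) :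
    opTensor R P t (opTensor R P t' a) = - opTensor R P t' (opTensor R P t a) := by
  induction t with
  | zero => simp
  | add t u ht hu => simp only [map_add, LinearMap.add_apply, ht, hu, neg_add]
  | tmul α x =>
    induction t' with
    | zero => simp
    | add t u ht hu => simp only [map_add, LinearMap.add_apply, ht, hu, neg_add]
    | tmul β y => exact op_op α β x y a

lemma opTensor_opTensor_self (t : Module.Dual R P ⊗[R] P) (a : KoszulAlg R P) :
    opTensor R P t (opTensor R P t a) = 0 := by
  induction t with
  | zero => simp
  | add t u ht hu =>
    simp only [map_add, LinearMap.add_apply, ht, hu, zero_add, add_zero]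
    rw [opTensor_opTensor u t, neg_add_cancel]
  | tmul α x => exact op_op_self α x a

lemma neg_one_pow_eq (m : ℕ) : ((-1) ^ m : KoszulAlg R P) = 1 ⊗ₜ ((-1) ^ m) := by
  have h := map_pow (Algebra.TensorProduct.includeRight : ExtDual R P →ₐ[R] KoszulAlg R P) (-1) m
  rw [map_neg, map_one] at h
  exact h.symm

lemma opTensor_leibniz (t : Module.Dual R P ⊗[R] P) {m : ℕ} {a : KoszulAlg R P} (b : KoszulAlg R P)
    (ha : a ∈ deg R P m) :
    opTensor R P t (a * b) = opTensor R P t a * b + (-1) ^ m * (a * opTensor R P t b) := by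
  induction t with
  | zero => simp
  | add t u ht hu =>
    simp only [map_add, LinearMap.add_apply, ht, hu, add_mul, mul_add]
    abel
  | tmul α x =>
    rw [deg_eq_span] at ha
    induction ha using Submodule.span_induction with
    | zero => simp
    | add a c _ _ ha hc =>
      simp only [map_add, ha, hc, add_mul, mul_add]
      abel
    | smul c a _ ha =>
      simp only [smul_mul_assoc, mul_smul_comm, map_smul, ha, smul_add]
    | mem a ha =>
      obtain ⟨w, hw, rfl⟩ := ha
      induction b using TensorProduct.induction_on with
      | zero => simp
      | add b c hb hc =>
        simp only [map_add, mul_add, hb, hc]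
        abel
      | tmul s v =>
        have h1 : ((-1) ^ m : KoszulAlg R P) = 1 ⊗ₜ ((-1) ^ m) := neg_one_pow_eq _
        simp only [TensorProduct.mk_apply, opTensor_tmul, op_tmul,
          Algebra.TensorProduct.tmul_mul_tmul, h1, one_mul, contract_leibniz _ v hw,
          TensorProduct.tmul_add]
        rw [mul_comm s]

lemma alg_graded_comm {m n : ℕ} {a b : KoszulAlg R P} (ha : a ∈ deg R P m) (hb : b ∈ deg R P n) :
    a * b = (-1) ^ (m * n) * (b * a) := by
  rw [deg_eq_span] at ha hb
  induction ha using Submodule.span_induction with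
  | zero => simp
  | add a c _ _ ha hc => simp only [ha, hc, add_mul, mul_add]
  | smul c a _ ha => simp only [smul_mul_assoc, mul_smul_comm, ha]
  | mem a ha =>
    obtain ⟨w, hw, rfl⟩ := ha
    induction hb using Submodule.span_induction with
    | zero => simp
    | add a c _ _ ha hc => simp only [ha, hc, add_mul, mul_add]
    | smul c a _ ha => simp only [smul_mul_assoc, mul_smul_comm, ha]
    | mem b hb =>
      obtain ⟨v, hv, rfl⟩ := hb
      have h1 : ((-1) ^ (m * n) : KoszulAlg R P) = 1 ⊗ₜ ((-1) ^ (m * n)) := neg_one_pow_eq _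
      simp only [TensorProduct.mk_apply, Algebra.TensorProduct.tmul_mul_tmul, h1, one_mul]
      rw [graded_comm hw hv]

variable (R P)

/-- The element `h(1) = ∑ⱼ αⱼ ⊗ xⱼ` of `P^∨ ⊗ P`, corresponding to the identity of `P` under the
canonical isomorphism `P^∨ ⊗ P ≃ Hom(P, P)`. -/
noncomputable def coev [Module.Finite R P] [Module.Projective R P] : Module.Dual R P ⊗[R] P :=
  (dualTensorHomEquiv R P P).symm LinearMap.id

/-- The differential of the fancy Koszul cdga,
`a ⊗ (β₁ ∧ ⋯ ∧ βₙ) ↦ ∑ⱼ a αⱼ ⊗ ∑ₖ (-1)ᵏ βₖ(xⱼ) (β₁ ∧ ⋯ ∧ β̌ₖ ∧ ⋯ ∧ βₙ)`,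
where `h(1) = ∑ⱼ αⱼ ⊗ xⱼ`. -/
noncomputable def differential [Module.Finite R P] [Module.Projective R P] :
    KoszulAlg R P →ₗ[SymDual R P] KoszulAlg R P :=
  - opTensor R P (coev R P)

variable [Module.Finite R P] [Module.Projective R P]

lemma differential_apply (a : KoszulAlg R P) :
    differential R P a = - opTensor R P (coev R P) a := rfl

lemma differential_leibniz {m : ℕ} {a : KoszulAlg R P} (b : KoszulAlg R P)
    (ha : a ∈ deg R P m) :
    differential R P (a * b) =
      differential R P a * b + (-1) ^ m * (a * differential R P b) := by
  have h {A : Type u} [Ring A] (x y z e w : A) : - (x * y + e * (z * w)) =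
      -x * y + e * (z * -w) := by
    rw [neg_mul, mul_neg, mul_neg, neg_add]
  rw [differential_apply, differential_apply, differential_apply, opTensor_leibniz _ b ha]
  exact h _ _ _ _ _

lemma differential_differential (a : KoszulAlg R P) :
    differential R P (differential R P a) = 0 := by
  rw [differential_apply, differential_apply, map_neg, opTensor_opTensor_self, neg_neg]

end FancyKoszul

open FancyKoszul in
/-- The fancy Koszul cdga `K(R; P) = (S ⊗_R ⋀ P^∨, d)` over `S = Sym_R(P^∨)`. -/
noncomputable def fancyKoszul (R P : Type u) [CommRing R] [AddCommGroup P] [Module R P]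
    [Module.Finite R P] [Module.Projective R P] : CDGA (SymDual R P) where
  carrier := KoszulAlg R P
  deg := deg R P
  d := differential R P
  d_mem := fun h => neg_mem (opTensor_mem _ h)
  d_zero := fun h => neg_eq_zero.2 (opTensor_of_mem_zero _ h)
  d_d := differential_differential R P
  leibniz := fun b h => differential_leibniz R P b h
  graded_comm := alg_graded_comm

/-- The ring `R`, viewed as an algebra over `Sym_R(P^∨)` by the zero section `P^∨ → R`. -/
def ZeroSection (R P : Type u) [CommRing R] [AddCommGroup P] [Module R P] : Type u := R

namespace ZeroSection

variable (R P : Type u) [CommRing R] [AddCommGroup P] [Module R P]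

instance : CommRing (ZeroSection R P) := inferInstanceAs (CommRing R)

instance : Algebra R (ZeroSection R P) := inferInstanceAs (Algebra R R)

noncomputable instance : Algebra (FancyKoszul.SymDual R P) (ZeroSection R P) :=
  (SymmetricAlgebra.lift (0 : Module.Dual R P →ₗ[R] ZeroSection R P)).toRingHom.toAlgebra

instance : IsScalarTower R (FancyKoszul.SymDual R P) (ZeroSection R P) :=
  IsScalarTower.of_algebraMap_eq fun r =>
    ((SymmetricAlgebra.lift (0 : Module.Dual R P →ₗ[R] ZeroSection R P)).commutes r).symm

/-- The ring `R` as a cdga over `Sym_R(P^∨)`, concentrated in degree `0`. -/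
noncomputable def cdga : CDGA (FancyKoszul.SymDual R P) :=
  CDGA.ofAlgebra (FancyKoszul.SymDual R P) (ZeroSection R P)

end ZeroSection

namespace FancyKoszul

variable (R P : Type u) [CommRing R] [AddCommGroup P] [Module R P]

/-- The augmentation `⋀ P^∨ → ⋀⁰ P^∨ = R` of the exterior algebra. -/
noncomputable def extAug : ExtDual R P →ₐ[R] ZeroSection R P :=
  ExteriorAlgebra.lift R ⟨0, fun _ => by simp⟩

/-- The augmentation `S ⊗_R ⋀ P^∨ → S → R`, as a morphism of `S`-algebras. -/
noncomputable def aug : KoszulAlg R P →ₐ[SymDual R P] ZeroSection R P :=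
  Algebra.TensorProduct.lift (Algebra.ofId (SymDual R P) (ZeroSection R P)) (extAug R P)
    (fun _ _ => Commute.all _ _)

variable {R P}

lemma extAug_eq_zero {n : ℕ} {w : ExtDual R P} (hw : w ∈ ⋀[R]^(n + 1) (Module.Dual R P)) :
    extAug R P w = 0 := by
  rw [ExteriorAlgebra.exteriorPower, pow_succ'] at hw
  induction hw using Submodule.mul_induction_on' with
  | mem_mul_mem x hx y hy =>
    obtain ⟨z, rfl⟩ := hx
    rw [map_mul, extAug, ExteriorAlgebra.lift_ι_apply, LinearMap.zero_apply, zero_mul]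
  | add x _ y _ hx hy => rw [map_add, hx, hy, add_zero]

lemma aug_eq_zero {n : ℕ} {a : KoszulAlg R P} (ha : a ∈ deg R P (n + 1)) : aug R P a = 0 := by
  rw [deg_eq_span] at ha
  induction ha using Submodule.span_induction with
  | zero => simp
  | add a b _ _ ha hb => rw [map_add, ha, hb, add_zero]
  | smul c a _ ha => rw [map_smul, ha, smul_zero]
  | mem a ha =>
    obtain ⟨w, hw, rfl⟩ := ha
    rw [TensorProduct.mk_apply, aug, Algebra.TensorProduct.lift_tmul, extAug_eq_zero hw, mul_zero]

lemma aug_opTensor (t : Module.Dual R P ⊗[R] P) (a : KoszulAlg R P) :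
    aug R P (opTensor R P t a) = 0 := by
  induction t with
  | zero => simp
  | add t u ht hu => rw [map_add, LinearMap.add_apply, map_add, ht, hu, add_zero]
  | tmul α x =>
    induction a using TensorProduct.induction_on with
    | zero => simp
    | add a b ha hb => rw [map_add, map_add, ha, hb, add_zero]
    | tmul a w =>
      have h : Algebra.ofId (SymDual R P) (ZeroSection R P) (SymmetricAlgebra.ι R _ α) = 0 :=
        SymmetricAlgebra.lift_ι_apply _ α
      rw [opTensor_tmul, op_tmul, aug, Algebra.TensorProduct.lift_tmul, map_mul, h, mul_zero,
        zero_mul]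

variable (R P)

lemma aug_differential [Module.Finite R P] [Module.Projective R P] (a : KoszulAlg R P) :
    aug R P (differential R P a) = 0 := by
  rw [differential_apply, map_neg, aug_opTensor, neg_zero]

/-- The augmentation `K(R; P) → R`, as a morphism of cdga's over `S = Sym_R(P^∨)`. -/
noncomputable def augmentation [Module.Finite R P] [Module.Projective R P] :
    fancyKoszul R P ⟶ ZeroSection.cdga R P :=
  CDGA.Hom.mk (A := fancyKoszul R P) (B := ZeroSection.cdga R P) (aug R P)
    (by
      intro n a ha
      cases n with
      | zero => exact CDGA.trivialDeg_zero (SymDual R P) (ZeroSection R P) _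
      | succ n =>
        have h : aug R P a ∈ CDGA.trivialDeg (SymDual R P) (ZeroSection R P) (n + 1) := by
          rw [aug_eq_zero ha]
          exact zero_mem _
        exact h)
    (by
      intro a
      exact aug_differential R P a)

end FancyKoszul

/-!
Let `d` be the Koszul differential, and let `H` be the polynomial de Rham differential
`s ⊗ ω ↦ ds ∧ ω`. Then `dH + Hd` acts on `Sym^p(P^∨) ⊗ ⋀^q P^∨` as `-(p + q)`, which is invertible
unless `p = q = 0`, since `R` is an algebra over `ℚ`.
So every cycle is a boundary up to a constant, and `K(R; P) → R` is a quasi-isomorphism.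

A morphism of cdga's from `K(R; P)` to `A` is an `R`-linear map `φ : P^∨ → A₁` with `φ(β)² = 0` and
`d φ(β) = -β`. The first condition holds automatically, because `2` is invertible and elements of
degree `1` anticommute with themselves. So lifting a morphism along a trivial fibration `A → B` is
lifting a linear map along `A₁ → B₁ ×_{B₀} A₀`. This map is surjective, and `P^∨` is projective.
-/

section Eigenspaces

open Module.End

variable {𝕜 V : Type*} [Field 𝕜] [AddCommGroup V] [Module 𝕜 V] {E : Module.End 𝕜 V}

lemma disjoint_ker_iSup_eigenspace : Disjoint E.ker (⨆ μ ≠ (0 : 𝕜), E.eigenspace μ) :=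
  eigenspace_zero E ▸ eigenspaces_iSupIndep E 0

lemma ker_eq_of_sup_iSup_eigenspace_eq_top {C : Submodule 𝕜 V} (hC : C ≤ E.ker)
    (h : C ⊔ ⨆ μ ≠ (0 : 𝕜), E.eigenspace μ = ⊤) : E.ker = C := by
  refine le_antisymm ?_ hC
  rw [← inf_top_eq E.ker, ← h, inf_comm, sup_inf_assoc_of_le _ hC, inf_comm,
    disjoint_ker_iSup_eigenspace.eq_bot, sup_bot_eq]

lemma isCompl_ker_range_of_iSup_eigenspace_eq_top (h : ⨆ μ, E.eigenspace μ = ⊤) :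
    IsCompl E.ker E.range := by
  have hsup : E.ker ⊔ ⨆ μ ≠ (0 : 𝕜), E.eigenspace μ = ⊤ := by
    rw [← h, ← eigenspace_zero, ← iSup_split_single]
  have hrange : E.range = ⨆ μ ≠ (0 : 𝕜), E.eigenspace μ := by
    apply le_antisymm
    · rw [← Submodule.map_top, ← hsup, Submodule.map_le_iff_le_comap, sup_le_iff]
      refine ⟨LinearMap.ker_le_comap E, iSup₂_le fun μ hμ x hx => ?_⟩
      rw [Submodule.mem_comap, mem_eigenspace_iff.1 hx]
      exact Submodule.smul_mem _ μ (Submodule.mem_iSup_of_mem μ (Submodule.mem_iSup_of_mem hμ hx))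
    · exact iSup₂_le fun μ hμ x hx =>
        ⟨μ⁻¹ • x, by rw [map_smul, mem_eigenspace_iff.1 hx, inv_smul_smul₀ hμ]⟩
  rw [hrange]
  exact ⟨disjoint_ker_iSup_eigenspace, codisjoint_iff.2 hsup⟩

lemma iSup_eigenspace_le_comap_of_lowering [LinearOrder 𝕜] [IsStrictOrderedRing 𝕜]
    {T : Module.End 𝕜 V} (hT : ∀ z, E (T z) = T (E z) - T z) :
    ⨆ μ ≤ (0 : 𝕜), E.eigenspace μ ≤ (⨆ μ < (0 : 𝕜), E.eigenspace μ).comap T := by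
  refine iSup₂_le fun μ hμ z hz => ?_
  have hμ' : μ - 1 < 0 := by linarith
  refine Submodule.mem_iSup_of_mem (μ - 1) (Submodule.mem_iSup_of_mem hμ' ?_)
  rw [mem_eigenspace_iff, hT, mem_eigenspace_iff.1 hz, map_smul, sub_smul, one_smul]

end Eigenspaces

lemma ker_le_ker_sup_range_of_homotopy {𝕜 V : Type*} [Ring 𝕜] [AddCommGroup V] [Module 𝕜 V]
    {δ H E : V →ₗ[𝕜] V} (hδ : δ ∘ₗ δ = 0) (hE : E = δ ∘ₗ H + H ∘ₗ δ)
    (hcompl : IsCompl E.ker E.range) :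
    δ.ker ≤ E.ker ⊔ δ.range := by
  have hδδ (x : V) : δ (δ x) = 0 := LinearMap.congr_fun hδ x
  have hE_apply (x : V) : E x = δ (H x) + H (δ x) := LinearMap.congr_fun hE x
  have hcomm (x : V) : E (δ x) = δ (E x) := by simp [hE_apply, hδδ]
  have hinj {x : V} (hx : x ∈ E.range) (h : E x = 0) : x = 0 :=
    Submodule.disjoint_def.1 hcompl.disjoint x h hx
  have hδ_range {x : V} : x ∈ E.range → δ x ∈ E.range := by
    rintro ⟨y, rfl⟩
    exact ⟨δ y, hcomm y⟩
  have hsplit (x : V) : ∃ c ∈ E.ker, ∃ e ∈ E.range, c + e = x :=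
    Submodule.mem_sup.1 (hcompl.sup_eq_top ▸ Submodule.mem_top)
  intro z hz
  obtain ⟨c, hc : E c = 0, e, he, rfl⟩ := hsplit z
  have hδe : δ e = 0 := by
    refine hinj (hδ_range he) ?_
    have : E (δ (c + e)) = 0 := by rw [hz, map_zero]
    rwa [map_add, map_add, hcomm, hc, map_zero, zero_add] at this
  refine Submodule.add_mem_sup hc ?_
  obtain ⟨x, rfl⟩ := he
  obtain ⟨c', hc' : E c' = 0, y, hy, rfl⟩ := hsplit x
  rw [map_add, hc', zero_add] at hδe ⊢
  have hδy : δ y = 0 := hinj (hδ_range hy) (by rw [hcomm, hδe])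
  exact ⟨H y, by rw [hE_apply, hδy, map_zero, add_zero]⟩

section SymmetricAlgebra

variable {R M N : Type*} [CommRing R] [AddCommGroup M] [Module R M] [AddCommGroup N] [Module R N]
  [Module (SymmetricAlgebra R M) N] [IsScalarTower R (SymmetricAlgebra R M) N]

/-- The derivation of `Sym_R(M)` which extends a given linear map on `M`. It is the second
component of the algebra morphism `Sym_R(M) → Sym_R(M) ⊕ ε N`, `m ↦ m + ε f(m)`. -/
noncomputable def symDerivation (f : M →ₗ[R] N) : Derivation R (SymmetricAlgebra R M) N :=
  letI : Module (SymmetricAlgebra R M)ᵐᵒᵖ N :=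
    Module.compHom N ((RingHom.id (SymmetricAlgebra R M)).fromOpposite fun _ _ => Commute.all _ _)
  haveI : IsCentralScalar (SymmetricAlgebra R M) N := ⟨fun _ _ => rfl⟩
  haveI : IsScalarTower R (SymmetricAlgebra R M)ᵐᵒᵖ N := ⟨fun r s n => smul_assoc r s.unop n⟩
  let F : SymmetricAlgebra R M →ₐ[R] TrivSqZeroExt (SymmetricAlgebra R M) N :=
    SymmetricAlgebra.lift
      ((TrivSqZeroExt.inlAlgHom R _ N).toLinearMap ∘ₗ SymmetricAlgebra.ι R M +
        (TrivSqZeroExt.inrHom (SymmetricAlgebra R M) N).restrictScalars R ∘ₗ f)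
  have fst_F (s : SymmetricAlgebra R M) : (F s).fst = s := by
    have h : (TrivSqZeroExt.fstHom R (SymmetricAlgebra R M) N).comp F = AlgHom.id R _ := by
      ext
      simp [F]
    exact DFunLike.congr_fun h s
  Derivation.mk'
    ((TrivSqZeroExt.sndHom (SymmetricAlgebra R M) N).restrictScalars R ∘ₗ F.toLinearMap)
    fun s t => by simp [fst_F]

@[simp]
lemma symDerivation_ι (f : M →ₗ[R] N) (m : M) :
    symDerivation f (SymmetricAlgebra.ι R M m) = f m := by
  simp [symDerivation]

end SymmetricAlgebra

/-- The algebra `Sym_R(M) ⊗ ⋀ M` of polynomial differential forms on the dual of `M`. -/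
abbrev PolyForm (R M : Type*) [CommRing R] [AddCommGroup M] [Module R M] : Type _ :=
  SymmetricAlgebra R M ⊗[R] ExteriorAlgebra R M

namespace PolyForm

variable {R M : Type*} [CommRing R] [AddCommGroup M] [Module R M]

/-- The form `dα = 1 ⊗ α`, for `α` in `M`. -/
noncomputable def dι : M →ₗ[R] PolyForm R M :=
  Algebra.TensorProduct.includeRight.toLinearMap ∘ₗ ExteriorAlgebra.ι R

@[elab_as_elim]
lemma induction {motive : PolyForm R M → Prop}
    (algebraMap : ∀ r : R, motive (algebraMap R _ r))
    (add : ∀ z w, motive z → motive w → motive (z + w))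
    (ι_smul : ∀ α z, motive z → motive (SymmetricAlgebra.ι R M α • z))
    (dι_mul : ∀ α z, motive z → motive (dι α * z))
    (z : PolyForm R M) : motive z := by
  suffices h : ∀ r : R, motive (r • z) from one_smul R z ▸ h 1
  have sym (s : SymmetricAlgebra R M) {z : PolyForm R M} (hz : ∀ r : R, motive (r • z)) (r : R) :
      motive (r • s • z) := by
    induction s using SymmetricAlgebra.induction generalizing z r with
    | algebraMap r' => simpa only [algebraMap_smul, smul_smul] using hz (r * r')
    | ι α => exact smul_comm r (SymmetricAlgebra.ι R M α) z ▸ ι_smul α _ (hz r)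
    | mul s t hs ht => exact mul_smul s t z ▸ hs (ht hz) r
    | add s t hs ht => simpa only [add_smul, smul_add] using add _ _ (hs hz r) (ht hz r)
  have ext (w : ExteriorAlgebra R M) {z : PolyForm R M} (hz : ∀ r : R, motive (r • z)) (r : R) :
      motive (r • (((1 : SymmetricAlgebra R M) ⊗ₜ[R] w) * z)) := by
    induction w using ExteriorAlgebra.induction generalizing z r with
    | algebraMap r' =>
      rw [← Algebra.TensorProduct.algebraMap_apply', ← Algebra.smul_def, smul_smul]
      exact hz (r * r')
    | ι α => exact mul_smul_comm r _ z ▸ dι_mul α _ (hz r)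
    | mul v w hv hw => simpa [← mul_assoc] using hv (hw hz) r
    | add v w hv hw =>
      simpa only [TensorProduct.tmul_add, add_mul, smul_add] using add _ _ (hv hz r) (hw hz r)
  have one (r : R) : motive (r • 1) :=
    Algebra.algebraMap_eq_smul_one (A := PolyForm R M) r ▸ algebraMap r
  induction z using TensorProduct.induction_on with
  | zero => exact fun r => by simpa using algebraMap 0
  | tmul s w => simpa [TensorProduct.smul_tmul'] using sym s (ext w one)
  | add z w hz hw => exact fun r => smul_add r z w ▸ add _ _ (hz r) (hw r)

lemma symDerivation_dι_mul_dι (s : SymmetricAlgebra R M) (α : M) :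
    symDerivation dι s * dι α = -(dι α * symDerivation dι s) := by
  induction s using SymmetricAlgebra.induction with
  | algebraMap r => simp
  | ι β =>
    rw [symDerivation_ι]
    simp only [dι, LinearMap.comp_apply, AlgHom.toLinearMap_apply, ← map_mul, ← map_neg]
    exact congrArg _ (eq_neg_of_add_eq_zero_left (ExteriorAlgebra.ι_add_mul_swap β α))
  | mul s t hs ht =>
    simp only [Derivation.leibniz, add_mul, mul_add, smul_mul_assoc, mul_smul_comm, hs, ht]
    simp only [smul_neg, neg_add]
  | add s t hs ht => simp [add_mul, mul_add, hs, ht, add_comm]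

/-- The de Rham differential `s ⊗ ω ↦ ds ∧ ω`. -/
noncomputable def deRham : PolyForm R M →ₗ[R] PolyForm R M :=
  LinearMap.mul' R (PolyForm R M) ∘ₗ
    TensorProduct.map (symDerivation dι).toLinearMap
      Algebra.TensorProduct.includeRight.toLinearMap

@[simp]
lemma deRham_tmul (s : SymmetricAlgebra R M) (w : ExteriorAlgebra R M) :
    deRham (s ⊗ₜ[R] w) = symDerivation dι s * (1 ⊗ₜ w) := by
  simp [deRham]

lemma deRham_algebraMap (r : R) : deRham (algebraMap R (PolyForm R M) r) = 0 := by
  simp [Algebra.TensorProduct.algebraMap_apply]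

lemma deRham_ι_smul (α : M) (z : PolyForm R M) :
    deRham (SymmetricAlgebra.ι R M α • z) =
      dι α * z + SymmetricAlgebra.ι R M α • deRham z := by
  induction z using TensorProduct.induction_on with
  | zero => simp
  | tmul s w =>
    simp only [TensorProduct.smul_tmul', smul_eq_mul, deRham_tmul, Derivation.leibniz,
      symDerivation_ι, add_mul, smul_mul_assoc]
    rw [add_comm]
    simp [dι, TensorProduct.smul_tmul']
  | add z w hz hw =>
    simp only [map_add, mul_add, smul_add, hz, hw]
    abel

lemma deRham_dι_mul (α : M) (z : PolyForm R M) :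
    deRham (dι α * z) = -(dι α * deRham z) := by
  induction z using TensorProduct.induction_on with
  | zero => simp
  | tmul s w =>
    calc deRham (dι α * s ⊗ₜ[R] w) = symDerivation dι s * dι α * (1 ⊗ₜ w) := by
          simp [dι, mul_assoc]
      _ = -(dι α * symDerivation dι s) * (1 ⊗ₜ w) := by rw [symDerivation_dι_mul_dι]
      _ = -(dι α * deRham (s ⊗ₜ[R] w)) := by
          rw [deRham_tmul, ← mul_assoc]
          exact neg_mul (dι α * symDerivation dι s) _
  | add z w hz hw =>
    simp only [map_add, mul_add, hz, hw, neg_add]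

end PolyForm

namespace FancyKoszul

open PolyForm

variable {R P : Type u} [CommRing R] [AddCommGroup P] [Module R P]

lemma dι_mem_deg (β : Module.Dual R P) : (dι β : KoszulAlg R P) ∈ deg R P 1 :=
  Submodule.tmul_mem_baseChange_of_mem _ (by
    rw [ExteriorAlgebra.exteriorPower, pow_one]
    exact LinearMap.mem_range_self _ β)

lemma opTensor_dι (t : Module.Dual R P ⊗[R] P) (β : Module.Dual R P) :
    opTensor R P t (dι β) =
      algebraMap (SymDual R P) _ (SymmetricAlgebra.ι R _ (β ∘ₗ dualTensorHom R P P t)) := by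
  induction t with
  | zero => simp
  | add t u ht hu => simp only [map_add, LinearMap.add_apply, ht, hu, LinearMap.comp_add]
  | tmul α x =>
    have hcontract : contract (Module.Dual.eval R P x) (ExteriorAlgebra.ι R β) =
        algebraMap R _ (β x) :=
      CliffordAlgebra.contractLeft_ι (Q := (0 : QuadraticForm R (Module.Dual R P))) _ β
    have hcomp : β ∘ₗ dualTensorHom R P P (α ⊗ₜ x) = β x • α := by
      ext y
      simp [mul_comm]
    rw [hcomp, map_smul, opTensor_tmul]
    simp [dι, op_tmul, hcontract, Algebra.algebraMap_eq_smul_one,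
      Algebra.TensorProduct.one_def, TensorProduct.smul_tmul']

variable [Module.Finite R P] [Module.Projective R P]

lemma differential_dι (β : Module.Dual R P) :
    differential R P (dι β) = -algebraMap (SymDual R P) _ (SymmetricAlgebra.ι R _ β) := by
  have hcoev : dualTensorHom R P P (coev R P) = LinearMap.id :=
    (dualTensorHomEquiv R P P).apply_symm_apply _
  rw [differential_apply, opTensor_dι, hcoev, LinearMap.comp_id]

lemma differential_algebraMap (r : R) :
    differential R P (algebraMap R (KoszulAlg R P) r) = 0 :=
  (fancyKoszul R P).d_zero (SetLike.algebraMap_mem_graded (deg R P) (algebraMap R (SymDual R P) r))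

lemma differential_dι_mul (α : Module.Dual R P) (z : KoszulAlg R P) :
    differential R P (dι α * z) =
      -(SymmetricAlgebra.ι R (Module.Dual R P) α • z) - dι α * differential R P z := by
  have neg_mul_add_neg_one_mul {A : Type u} [Ring A] (a z w : A) :
      -a * z + (-1) ^ 1 * w = -(a * z) - w := by
    noncomm_ring
  rw [differential_leibniz _ _ _ (dι_mem_deg α), differential_dι,
    algebra_compatible_smul (KoszulAlg R P)]
  exact neg_mul_add_neg_one_mul _ _ _

variable (R P) in
/-- The operator `d H + H d` on `K(R; P)`, where `d` is the Koszul differential and `H` the de Rham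
differential. -/
noncomputable def euler : KoszulAlg R P →ₗ[R] KoszulAlg R P :=
  (differential R P).restrictScalars R ∘ₗ deRham + deRham ∘ₗ (differential R P).restrictScalars R

lemma euler_apply (z : KoszulAlg R P) :
    euler R P z = differential R P (deRham z) + deRham (differential R P z) := rfl

lemma euler_algebraMap (r : R) : euler R P (algebraMap R _ r) = 0 := by
  rw [euler_apply, deRham_algebraMap, differential_algebraMap, map_zero, map_zero, add_zero]

lemma euler_ι_smul (α : Module.Dual R P) (z : KoszulAlg R P) :
    euler R P (SymmetricAlgebra.ι R (Module.Dual R P) α • z) =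
      SymmetricAlgebra.ι R (Module.Dual R P) α • euler R P z -
        SymmetricAlgebra.ι R (Module.Dual R P) α • z := by
  simp only [euler_apply, deRham_ι_smul, map_add, map_smul, differential_dι_mul, smul_add]
  abel

lemma euler_dι_mul (α : Module.Dual R P) (z : KoszulAlg R P) :
    euler R P (dι α * z) = dι α * euler R P z - dι α * z := by
  have hneg (w : KoszulAlg R P) : differential R P (-w) = -differential R P w := map_neg _ w
  simp only [euler_apply, deRham_dι_mul, hneg, map_sub, map_neg, deRham_ι_smul,
    differential_dι_mul, mul_add]
  abel

section Rational

open Module.End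

variable [Algebra ℚ R] [Module ℚ (KoszulAlg R P)]

lemma one_le_ker_euler :
    (1 : Submodule R (KoszulAlg R P)).restrictScalars ℚ ≤ ((euler R P).restrictScalars ℚ).ker := by
  intro z hz
  obtain ⟨r, rfl⟩ := Submodule.mem_one.1 hz
  exact euler_algebraMap r

lemma one_sup_iSup_eigenspace_euler :
    (1 : Submodule R (KoszulAlg R P)).restrictScalars ℚ ⊔
      ⨆ μ < (0 : ℚ), eigenspace ((euler R P).restrictScalars ℚ) μ = ⊤ := by
  set E : Module.End ℚ (KoszulAlg R P) := (euler R P).restrictScalars ℚ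
  set C : Submodule ℚ (KoszulAlg R P) := (1 : Submodule R (KoszulAlg R P)).restrictScalars ℚ
  have hle : C ⊔ ⨆ μ < (0 : ℚ), E.eigenspace μ ≤ ⨆ μ ≤ (0 : ℚ), E.eigenspace μ := by
    refine sup_le ?_ (biSup_mono fun _ => le_of_lt)
    exact one_le_ker_euler.trans ((eigenspace_zero E).ge.trans (le_iSup₂_of_le 0 le_rfl le_rfl))
  have lowering {T : Module.End ℚ (KoszulAlg R P)} (hT : ∀ z, E (T z) = T (E z) - T z)
      {z : KoszulAlg R P} (hz : z ∈ C ⊔ ⨆ μ < (0 : ℚ), E.eigenspace μ) :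
      T z ∈ C ⊔ ⨆ μ < (0 : ℚ), E.eigenspace μ :=
    Submodule.mem_sup_right (iSup_eigenspace_le_comap_of_lowering hT (hle hz))
  refine eq_top_iff.2 fun z _ => ?_
  induction z using PolyForm.induction with
  | algebraMap r => exact Submodule.mem_sup_left (Submodule.mem_one.2 ⟨r, rfl⟩)
  | add z w hz hw => exact add_mem (hz trivial) (hw trivial)
  | ι_smul α z hz =>
    exact lowering (T := (Algebra.lsmul R R (KoszulAlg R P)
      (SymmetricAlgebra.ι R (Module.Dual R P) α)).restrictScalars ℚ) (euler_ι_smul α) (hz trivial)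
  | dι_mul α z hz =>
    exact lowering (T := (LinearMap.mulLeft R (dι α : KoszulAlg R P)).restrictScalars ℚ)
      (euler_dι_mul α) (hz trivial)

lemma ker_euler :
    ((euler R P).restrictScalars ℚ).ker = (1 : Submodule R (KoszulAlg R P)).restrictScalars ℚ := by
  refine ker_eq_of_sup_iSup_eigenspace_eq_top one_le_ker_euler (top_le_iff.1 ?_)
  rw [← one_sup_iSup_eigenspace_euler]
  exact sup_le_sup_left (biSup_mono fun _ => ne_of_lt) _

lemma iSup_eigenspace_euler : ⨆ μ, eigenspace ((euler R P).restrictScalars ℚ) μ = ⊤ := by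
  rw [← top_le_iff, ← one_sup_iSup_eigenspace_euler]
  refine sup_le ?_ (iSup_mono fun μ => iSup_le fun _ => le_rfl)
  exact one_le_ker_euler.trans ((eigenspace_zero _).ge.trans (le_iSup _ 0))

end Rational

lemma exists_eq_algebraMap_add_differential [Algebra ℚ R] {z : KoszulAlg R P}
    (hz : differential R P z = 0) :
    ∃ (r : R) (y : KoszulAlg R P), z = algebraMap R _ r + differential R P y := by
  let _ : Module ℚ (KoszulAlg R P) := Module.compHom _ (algebraMap ℚ R)
  let δ : KoszulAlg R P →ₗ[ℚ] KoszulAlg R P :=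
    ((differential R P).restrictScalars R).restrictScalars ℚ
  have hδ : δ ∘ₗ δ = 0 := LinearMap.ext (differential_differential R P)
  have hmem := ker_le_ker_sup_range_of_homotopy (E := (euler R P).restrictScalars ℚ)
    (H := deRham.restrictScalars ℚ) hδ rfl
    (isCompl_ker_range_of_iSup_eigenspace_eq_top iSup_eigenspace_euler) (LinearMap.mem_ker.2 hz)
  rw [ker_euler] at hmem
  obtain ⟨_, hone, _, ⟨y, rfl⟩, rfl⟩ := Submodule.mem_sup.1 hmem
  obtain ⟨r, rfl⟩ := Submodule.mem_one.1 hone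
  exact ⟨r, y, rfl⟩

end FancyKoszul

section QuasiIso

variable {A : Type u} [Ring A] {ι : Type*} {c : ComplexShape ι}
  {K L : HomologicalComplex (ModuleCat.{u} A) c} (φ : K ⟶ L) {i j k : ι}

lemma exists_d_eq_of_quasiIsoAt [QuasiIsoAt φ j] (hi : c.prev j = i) (hk : c.next j = k)
    {x : K.X j} (hx : K.d j k x = 0) {y : L.X i} (hy : L.d i j y = φ.f j x) :
    ∃ x' : K.X i, K.d i j x' = x := by
  obtain ⟨A', π, hπ, x', hx'⟩ :=
    (HomologicalComplex.mono_homologyMap_iff_up_to_refinements φ i j k hi hk).1 inferInstance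
      (ModuleCat.ofHom (LinearMap.toSpanSingleton A _ x)) (by ext; simpa using hx)
      (ModuleCat.ofHom (LinearMap.toSpanSingleton A _ y)) (by ext; simpa using hy.symm)
  obtain ⟨a, ha⟩ := (ModuleCat.epi_iff_surjective π).1 hπ 1
  refine ⟨x' a, ?_⟩
  simpa [ha] using (ConcreteCategory.congr_hom hx' a).symm

lemma exists_eq_add_d_of_quasiIsoAt [QuasiIsoAt φ j] (hi : c.prev j = i) (hk : c.next j = k)
    {y : L.X j} (hy : L.d j k y = 0) :
    ∃ x : K.X j, K.d j k x = 0 ∧ ∃ z : L.X i, y = φ.f j x + L.d i j z := by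
  obtain ⟨A', π, hπ, x, hx, z, hz⟩ :=
    (HomologicalComplex.epi_homologyMap_iff_up_to_refinements φ i j k hi hk).1 inferInstance
      (ModuleCat.ofHom (LinearMap.toSpanSingleton A _ y)) (by ext; simpa using hy)
  obtain ⟨a, ha⟩ := (ModuleCat.epi_iff_surjective π).1 hπ 1
  refine ⟨x a, by simpa using ConcreteCategory.congr_hom hx a, z a, ?_⟩
  simpa [ha] using ConcreteCategory.congr_hom hz a

end QuasiIso

namespace CDGA

variable {S : Type u} [CommRing S]

lemma toComplex_d (A : CDGA S) (n : ℕ) :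
    ((toComplex S).obj A).d (n + 1) n = ModuleCat.ofHom (A.dRestrict n) :=
  ChainComplex.of_d (fun n => ModuleCat.of S (A.deg n)) (fun n => ModuleCat.ofHom (A.dRestrict n)) n

lemma toComplex_d_apply (A : CDGA S) (n : ℕ) (a : A.deg (n + 1)) :
    (((toComplex S).obj A).d (n + 1) n a : A.deg n) = A.dRestrict n a :=
  ConcreteCategory.congr_hom (A.toComplex_d n) a

lemma toComplex_d_apply_eq_zero {A : CDGA S} {n m : ℕ} {a : A.deg n} (ha : A.d a = 0) :
    ((toComplex S).obj A).d n m a = 0 := by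
  by_cases hm : m + 1 = n
  · subst hm
    exact (A.toComplex_d_apply m a).trans (Subtype.ext ha)
  · exact ConcreteCategory.congr_hom (((toComplex S).obj A).shape n m hm) a

lemma exactAt_succ_iff (A : CDGA S) (n : ℕ) :
    ((toComplex S).obj A).ExactAt (n + 1) ↔
      ∀ a ∈ A.deg (n + 1), A.d a = 0 → ∃ b ∈ A.deg (n + 2), A.d b = a := by
  rw [HomologicalComplex.exactAt_iff' _ (n + 2) (n + 1) n (by simp) (by simp),
    ShortComplex.moduleCat_exact_iff]
  constructor
  · intro h a ha hd
    obtain ⟨b, hb⟩ := h (⟨a, ha⟩ : A.deg (n + 1)) (toComplex_d_apply_eq_zero hd)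
    exact ⟨b.1, b.2, congrArg Subtype.val ((toComplex_d_apply A (n + 1) b).symm.trans hb)⟩
  · intro h a ha
    obtain ⟨b, hb, hd⟩ := h a.1 a.2
      (congrArg Subtype.val ((toComplex_d_apply A n a).symm.trans ha))
    exact ⟨(⟨b, hb⟩ : A.deg (n + 2)), (toComplex_d_apply A (n + 1) _).trans (Subtype.ext hd)⟩

lemma mul_self_eq_zero_of_mem_deg_one (h2 : IsUnit (2 : S)) {A : CDGA S}
    {a : A.carrier} (ha : a ∈ A.deg 1) : a * a = 0 := by
  have h := A.graded_comm ha ha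
  rw [mul_one, pow_one, neg_one_mul, eq_neg_iff_add_eq_zero, ← two_smul S] at h
  exact h2.smul_eq_zero.1 h

section TrivialFibration

variable {A B : CDGA S} {p : A ⟶ B}

lemma exists_lift_of_trivialFibration (hp : trivialFibrations (CDGA S) p) {n : ℕ}
    {b : B.carrier} (hb : b ∈ B.deg (n + 1)) {a₀ : A.carrier} (ha₀ : a₀ ∈ A.deg n)
    (hda₀ : A.d a₀ = 0) (hdb : B.d b = p.toAlgHom a₀) :
    ∃ a ∈ A.deg (n + 1), p.toAlgHom a = b ∧ A.d a = a₀ := by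
  obtain ⟨hfib, hwe⟩ := hp
  have hqis : QuasiIso ((toComplex S).map p) := hwe
  obtain ⟨⟨a, ha⟩, hda⟩ := exists_d_eq_of_quasiIsoAt ((toComplex S).map p) (i := n + 1) (j := n)
    (by simp) rfl (toComplex_d_apply_eq_zero (a := ⟨a₀, ha₀⟩) hda₀)
    (y := (⟨b, hb⟩ : B.deg (n + 1))) ((toComplex_d_apply B n _).trans (Subtype.ext hdb))
  replace hda : A.d a = a₀ := congrArg Subtype.val ((toComplex_d_apply A n ⟨a, ha⟩).symm.trans hda)
  have hcycle : B.d (b - p.toAlgHom a) = 0 := by rw [map_sub, hdb, ← p.map_d, hda, sub_self]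
  obtain ⟨⟨z, hz⟩, hdz, ⟨w, hw⟩, hbzw⟩ := exists_eq_add_d_of_quasiIsoAt ((toComplex S).map p)
    (i := n + 2) (j := n + 1) (k := n) (by simp) (by simp)
    (toComplex_d_apply_eq_zero (a := ⟨_, sub_mem hb (p.map_deg ha)⟩) hcycle)
  replace hdz : A.d z = 0 :=
    congrArg Subtype.val ((toComplex_d_apply A n ⟨z, hz⟩).symm.trans hdz)
  replace hbzw : b - p.toAlgHom a = p.toAlgHom z + B.d w :=
    congrArg Subtype.val (hbzw.trans
      (congrArg (Hom.restrict p (n + 1) ⟨z, hz⟩ + ·) (toComplex_d_apply B (n + 1) ⟨w, hw⟩)))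
  obtain ⟨⟨v, hv⟩, hvw⟩ := hfib (n + 2) (by omega) ⟨w, hw⟩
  replace hvw : p.toAlgHom v = w := congrArg Subtype.val hvw
  refine ⟨a + z + A.d v, add_mem (add_mem ha hz) (A.d_mem hv), ?_, ?_⟩
  · rw [map_add, map_add, p.map_d, hvw, add_assoc, ← hbzw, add_sub_cancel]
  · rw [map_add, map_add, hda, hdz, A.d_d, add_zero, add_zero]

lemma exists_linearMap_lift_of_trivialFibration (hp : trivialFibrations (CDGA S) p) {n : ℕ}
    {M : Type*} [AddCommGroup M] [Module S M] [Module.Projective S M]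
    {β : M →ₗ[S] B.carrier} (hβ : ∀ m, β m ∈ B.deg (n + 1))
    {α₀ : M →ₗ[S] A.carrier} (hα₀ : ∀ m, α₀ m ∈ A.deg n) (hdα₀ : ∀ m, A.d (α₀ m) = 0)
    (hdβ : ∀ m, B.d (β m) = p.toAlgHom (α₀ m)) :
    ∃ α : M →ₗ[S] A.carrier, (∀ m, α m ∈ A.deg (n + 1)) ∧ (∀ m, p.toAlgHom (α m) = β m) ∧
      ∀ m, A.d (α m) = α₀ m := by
  let q : A.deg (n + 1) →ₗ[S] B.carrier × A.carrier :=
    (p.toAlgHom.toLinearMap.prod A.d).domRestrict (A.deg (n + 1))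
  have hrange (m : M) : (β.prod α₀) m ∈ q.range := by
    obtain ⟨a, ha, hpa, hda⟩ :=
      exists_lift_of_trivialFibration hp (hβ m) (hα₀ m) (hdα₀ m) (hdβ m)
    exact ⟨⟨a, ha⟩, Prod.ext hpa hda⟩
  obtain ⟨α, hα⟩ := Module.projective_lifting_property q.rangeRestrict
    ((β.prod α₀).codRestrict _ hrange) q.surjective_rangeRestrict
  have hα' (m : M) : q (α m) = (β m, α₀ m) := congrArg Subtype.val (DFunLike.congr_fun hα m)
  exact ⟨(A.deg (n + 1)).subtype ∘ₗ α, fun m => (α m).2, fun m => congrArg Prod.fst (hα' m),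
    fun m => congrArg Prod.snd (hα' m)⟩

end TrivialFibration

open DirectSum in
lemma d_decompose (A : CDGA S) (a : A.carrier) (n : ℕ) :
    A.d (decompose A.deg a (n + 1)) = decompose A.deg (A.d a) n := by
  induction a using DirectSum.Decomposition.inductionOn A.deg with
  | zero => simp
  | add a b ha hb =>
    simp only [map_add, decompose_add, DirectSum.add_apply, Submodule.coe_add, ha, hb]
  | @homogeneous i a =>
    obtain ⟨a, ha⟩ := a
    cases i with
    | zero =>
      rw [A.d_zero ha, decompose_of_mem_ne A.deg ha (Nat.succ_ne_zero n).symm]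
      simp
    | succ i =>
      by_cases h : i = n
      · subst h
        rw [decompose_of_mem_same A.deg ha, decompose_of_mem_same A.deg (A.d_mem ha)]
      · rw [decompose_of_mem_ne A.deg ha (by omega), decompose_of_mem_ne A.deg (A.d_mem ha) h,
          map_zero]

section OfAlgebra

variable {B : Type u} [CommRing B] [Algebra S B]

lemma exactAt_ofAlgebra (n : ℕ) : ((toComplex S).obj (ofAlgebra S B)).ExactAt (n + 1) :=
  (exactAt_succ_iff _ n).2 fun _ hb _ =>
    ⟨0, zero_mem _, (eq_zero_of_mem_trivialDeg (B := B) n.succ_ne_zero hb).symm⟩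

variable (S B) in
lemma nonempty_homology_ofAlgebra_iso :
    Nonempty (((toComplex S).obj (ofAlgebra S B)).homology 0 ≅ ModuleCat.of S B) := by
  let K := (toComplex S).obj (ofAlgebra S B)
  have hd₁ : K.d 1 0 = 0 := toComplex_d _ 0
  have hd₀ : K.d 0 0 = 0 := K.shape _ _ (by simp)
  let e : K.X 0 ≅ ModuleCat.of S B := (LinearEquiv.ofTop (trivialDeg S B 0) rfl).toModuleIso
  exact ⟨(K.isoHomologyπ 1 0 (by simp) hd₁).symm ≪≫ K.iCyclesIso 0 0 (by simp) hd₀ ≪≫ e⟩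

lemma fibration_ofAlgebra {A : CDGA S} (f : A ⟶ ofAlgebra S B) : Fibration f :=
  ⟨fun _ hn b => ⟨0, Subtype.ext
    ((map_zero _).trans (eq_zero_of_mem_trivialDeg (B := B) hn.ne' b.2).symm)⟩⟩

lemma quasiIso_ofAlgebra {A : CDGA S} {f : A ⟶ ofAlgebra S B}
    (hsurj : Function.Surjective (Hom.restrict f 0))
    (hexact : ∀ n, ∀ a ∈ A.deg n, A.d a = 0 → f.toAlgHom a = 0 → ∃ b ∈ A.deg (n + 1), A.d b = a) :
    QuasiIso ((toComplex S).map f) := by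
  refine ⟨fun n => ?_⟩
  cases n with
  | zero =>
    have shape (C : CDGA S) : ((toComplex S).obj C).d 0 0 = 0 :=
      ((toComplex S).obj C).shape 0 0 (by simp)
    rw [quasiIsoAt_iff' _ 1 0 0 (by simp) (by simp),
      ShortComplex.quasiIso_iff_of_zeros' _ (shape A) (toComplex_d _ 0) (shape _),
      ShortComplex.moduleCat_exact_iff, ModuleCat.epi_iff_surjective]
    refine ⟨fun a ha => ?_, hsurj⟩
    obtain ⟨b, hb, hd⟩ := hexact 0 a.1 a.2 (A.d_zero a.2) (congrArg Subtype.val ha)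
    exact ⟨(⟨b, hb⟩ : A.deg 1), (toComplex_d_apply A 0 _).trans (Subtype.ext hd)⟩
  | succ n =>
    refine (quasiIsoAt_iff_exactAt' _ _ (exactAt_ofAlgebra n)).2 ((exactAt_succ_iff A n).2 ?_)
    exact fun a ha hd => hexact _ a ha hd
      (eq_zero_of_mem_trivialDeg (B := B) n.succ_ne_zero (f.map_deg ha))

end OfAlgebra

end CDGA

namespace FancyKoszul

variable {R P : Type u} [CommRing R] [AddCommGroup P] [Module R P]

lemma aug_algebraMap (r : R) : aug R P (algebraMap R _ r) = algebraMap R (ZeroSection R P) r :=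
  AlgHom.commutes ((aug R P).restrictScalars R) r

variable [Module.Finite R P] [Module.Projective R P]

lemma exists_differential_eq_of_aug_eq_zero [Algebra ℚ R] {n : ℕ} {z : KoszulAlg R P}
    (hz : z ∈ deg R P n) (hdz : differential R P z = 0) (haug : aug R P z = 0) :
    ∃ y ∈ deg R P (n + 1), differential R P y = z := by
  obtain ⟨r, y, rfl⟩ := exists_eq_algebraMap_add_differential hdz
  have hr : r = 0 := by
    rwa [map_add, aug_differential, add_zero, aug_algebraMap] at haug
  rw [hr, map_zero, zero_add] at hz ⊢
  refine ⟨DirectSum.decompose (deg R P) y (n + 1), SetLike.coe_mem _, ?_⟩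
  exact ((fancyKoszul R P).d_decompose y n).trans (DirectSum.decompose_of_mem_same (deg R P) hz)

lemma surjective_augmentation_restrict_zero :
    Function.Surjective (CDGA.Hom.restrict (augmentation R P) 0) := fun b =>
  ⟨⟨algebraMap (SymDual R P) (KoszulAlg R P) (algebraMap R _ b.1),
    SetLike.algebraMap_mem_graded (deg R P) _⟩, Subtype.ext (aug_algebraMap (R := R) (P := P) b.1)⟩

variable (R P) in
lemma quasiIso_augmentation [Algebra ℚ R] :
    QuasiIso ((CDGA.toComplex _).map (augmentation R P)) :=
  CDGA.quasiIso_ofAlgebra (B := ZeroSection R P) surjective_augmentation_restrict_zero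
    fun _ _ hz hdz haug => exists_differential_eq_of_aug_eq_zero hz hdz haug

end FancyKoszul

section BaseChangeExterior

variable {R S M B : Type*} [CommRing R] [CommRing S] [Algebra R S] [AddCommGroup M] [Module R M]
  [Ring B] [Algebra S B]

lemma exists_algHom_baseChange_exteriorAlgebra {φ : S ⊗[R] M →ₗ[S] B}
    (hφ : ∀ m, φ (1 ⊗ₜ m) * φ (1 ⊗ₜ m) = 0) :
    ∃ f : S ⊗[R] ExteriorAlgebra R M →ₐ[S] B,
      ∀ m, f (1 ⊗ₜ ExteriorAlgebra.ι R m) = φ (1 ⊗ₜ m) := by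
  let _ : Algebra R B := Algebra.compHom B (algebraMap R S)
  have : IsScalarTower R S B := .of_algebraMap_eq fun _ => rfl
  let ψ : M →ₗ[R] B := φ.restrictScalars R ∘ₗ TensorProduct.mk R S M 1
  refine ⟨Algebra.TensorProduct.lift (Algebra.ofId S B) (ExteriorAlgebra.lift R ⟨ψ, hφ⟩)
    fun s _ => Algebra.commutes s _, fun m => ?_⟩
  refine (Algebra.TensorProduct.lift_tmul ..).trans ?_
  rw [map_one, one_mul]
  exact ExteriorAlgebra.lift_ι_apply R ψ hφ m

lemma algHom_baseChange_exteriorAlgebra_ext {f g : S ⊗[R] ExteriorAlgebra R M →ₐ[S] B}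
    (h : ∀ m, f (1 ⊗ₜ ExteriorAlgebra.ι R m) = g (1 ⊗ₜ ExteriorAlgebra.ι R m)) : f = g := by
  let _ : Algebra R B := Algebra.compHom B (algebraMap R S)
  have : IsScalarTower R S B := .of_algebraMap_eq fun _ => rfl
  exact Algebra.TensorProduct.ext (Subsingleton.elim _ _)
    (ExteriorAlgebra.hom_ext (LinearMap.ext h))

end BaseChangeExterior

namespace FancyKoszul

open PolyForm

variable {R P : Type u} [CommRing R] [AddCommGroup P] [Module R P]

lemma algHom_mem_deg {A : CDGA (SymDual R P)} {f : KoszulAlg R P →ₐ[SymDual R P] A.carrier}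
    (hf : ∀ β, f (dι β) ∈ A.deg 1) {n : ℕ} {z : KoszulAlg R P} (hz : z ∈ deg R P n) :
    f z ∈ A.deg n := by
  suffices h : ∀ w ∈ ⋀[R]^n (Module.Dual R P), f (1 ⊗ₜ w) ∈ A.deg n by
    rw [deg_eq_span] at hz
    refine (Submodule.span_le (p := (A.deg n).comap f.toLinearMap)).2 ?_ hz
    rintro _ ⟨w, hw, rfl⟩
    exact h w hw
  clear hz
  intro w hw
  induction hw using Submodule.pow_induction_on_left' with
  | algebraMap r =>
    rw [← Algebra.TensorProduct.algebraMap_apply',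
      IsScalarTower.algebraMap_apply R (SymDual R P) (KoszulAlg R P), AlgHom.commutes]
    exact SetLike.algebraMap_mem_graded A.deg _
  | add v w _ _ _ hv hw =>
    rw [TensorProduct.tmul_add, map_add]
    exact add_mem hv hw
  | mem_mul x hx n w _ hw =>
    obtain ⟨β, rfl⟩ := hx
    have hmul : (1 : SymDual R P) ⊗ₜ[R] (ExteriorAlgebra.ι R β * w) = dι β * 1 ⊗ₜ w := by
      simp [dι]
    rw [hmul, map_mul, Nat.succ_eq_one_add]
    exact SetLike.mul_mem_graded (hf β) hw

/-- The `S`-linear inclusion of the generators `S ⊗ P^∨` of `K(R; P)`, where `S = Sym(P^∨)`. -/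
noncomputable def generators :
    SymDual R P ⊗[R] Module.Dual R P →ₗ[SymDual R P] KoszulAlg R P :=
  LinearMap.liftBaseChange (SymDual R P) dι

/-- The value `S ⊗ P^∨ → S`, `s ⊗ β ↦ -s β`, of the differential of `K(R; P)` on generators. -/
noncomputable def generatorsBoundary :
    SymDual R P ⊗[R] Module.Dual R P →ₗ[SymDual R P] SymDual R P :=
  LinearMap.liftBaseChange (SymDual R P) (-SymmetricAlgebra.ι R (Module.Dual R P))

lemma generators_one_tmul (β : Module.Dual R P) :
    generators ((1 : SymDual R P) ⊗ₜ[R] β) = dι β := by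
  rw [generators, LinearMap.liftBaseChange_tmul, one_smul]

lemma generatorsBoundary_one_tmul (β : Module.Dual R P) :
    generatorsBoundary ((1 : SymDual R P) ⊗ₜ[R] β) = -SymmetricAlgebra.ι R _ β := by
  rw [generatorsBoundary, LinearMap.liftBaseChange_tmul, one_smul, LinearMap.neg_apply]

lemma generators_mem_deg (z : SymDual R P ⊗[R] Module.Dual R P) : generators z ∈ deg R P 1 := by
  induction z with
  | zero => simp only [map_zero, zero_mem]
  | add z w hz hw => simpa only [map_add] using add_mem hz hw
  | tmul s β =>
    rw [generators, LinearMap.liftBaseChange_tmul]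
    exact Submodule.smul_mem _ s (dι_mem_deg β)

variable [Module.Finite R P] [Module.Projective R P]

lemma algHom_differential {A : CDGA (SymDual R P)}
    {f : KoszulAlg R P →ₐ[SymDual R P] A.carrier} (hf : ∀ β, f (dι β) ∈ A.deg 1)
    (hd : ∀ β, f (differential R P (dι β)) = A.d (f (dι β))) (z : KoszulAlg R P) :
    f (differential R P z) = A.d (f z) := by
  induction z using PolyForm.induction with
  | algebraMap r =>
    rw [differential_algebraMap, map_zero, eq_comm,
      IsScalarTower.algebraMap_apply R (SymDual R P) (KoszulAlg R P), AlgHom.commutes]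
    exact A.d_zero (SetLike.algebraMap_mem_graded A.deg _)
  | add z w hz hw => simp only [map_add, hz, hw]
  | ι_smul α z hz => simp only [map_smul, hz]
  | dι_mul β z hz =>
    rw [differential_leibniz _ _ _ (dι_mem_deg β), map_mul, A.leibniz _ (hf β)]
    simp only [map_add, map_mul, map_pow, hd, hz]
    congr 3
    exact (map_neg f 1).trans (congrArg _ (map_one f))

/-- The morphism of cdga's out of `K(R; P)` given by a morphism of algebras which is compatible
with the degrees and the differentials on the generators `dι β`. -/
noncomputable def homOfGenerators {A : CDGA (SymDual R P)}
    (f : KoszulAlg R P →ₐ[SymDual R P] A.carrier) (hf : ∀ β, f (dι β) ∈ A.deg 1)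
    (hd : ∀ β, f (differential R P (dι β)) = A.d (f (dι β))) : fancyKoszul R P ⟶ A :=
  CDGA.Hom.mk (A := fancyKoszul R P) f (algHom_mem_deg hf) (algHom_differential hf hd)

lemma fancyKoszul_hom_ext {A : CDGA (SymDual R P)} {f g : fancyKoszul R P ⟶ A}
    (h : ∀ β : Module.Dual R P, f.toAlgHom (dι β : KoszulAlg R P) =
      g.toAlgHom (dι β : KoszulAlg R P)) : f = g :=
  CDGA.Hom.ext (algHom_baseChange_exteriorAlgebra_ext h)

lemma differential_generators (z : SymDual R P ⊗[R] Module.Dual R P) :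
    differential R P (generators z) =
      algebraMap (SymDual R P) (KoszulAlg R P) (generatorsBoundary z) := by
  have h : differential R P ∘ₗ generators =
      Algebra.linearMap (SymDual R P) (KoszulAlg R P) ∘ₗ generatorsBoundary := by
    ext β : 3
    refine (congrArg _ (generators_one_tmul β)).trans ((differential_dι β).trans ?_)
    refine (map_neg (algebraMap (SymDual R P) (KoszulAlg R P)) _).symm.trans ?_
    exact congrArg _ (generatorsBoundary_one_tmul β).symm
  exact DFunLike.congr_fun h z

lemma exists_lift_of_trivialFibration (h2 : IsUnit (2 : R)) {A B : CDGA (SymDual R P)} {p : A ⟶ B}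
    (hp : trivialFibrations (CDGA (SymDual R P)) p) (g : fancyKoszul R P ⟶ B) :
    ∃ l : fancyKoszul R P ⟶ A, l ≫ p = g := by
  have hd_lift (z : SymDual R P ⊗[R] Module.Dual R P) :
      B.d (g.toAlgHom (generators z)) =
        p.toAlgHom (algebraMap (SymDual R P) A.carrier (generatorsBoundary z)) :=
    calc B.d (g.toAlgHom (generators z))
      _ = g.toAlgHom (differential R P (generators z)) := (g.map_d _).symm
      _ = g.toAlgHom (algebraMap (SymDual R P) (KoszulAlg R P) (generatorsBoundary z)) :=
        congrArg _ (differential_generators z)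
      _ = algebraMap (SymDual R P) B.carrier (generatorsBoundary z) := AlgHom.commutes _ _
      _ = p.toAlgHom (algebraMap (SymDual R P) A.carrier (generatorsBoundary z)) :=
        (AlgHom.commutes _ _).symm
  obtain ⟨φ, hφ_deg, hφ_lift, hφ_d⟩ := CDGA.exists_linearMap_lift_of_trivialFibration hp
    (β := LinearMap.comp g.toAlgHom.toLinearMap generators)
    (α₀ := Algebra.linearMap (SymDual R P) A.carrier ∘ₗ generatorsBoundary)
    (fun z => g.map_deg (generators_mem_deg z)) (fun z => SetLike.algebraMap_mem_graded A.deg _)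
    (fun z => A.d_zero (SetLike.algebraMap_mem_graded A.deg _)) hd_lift
  obtain ⟨f, hf⟩ := exists_algHom_baseChange_exteriorAlgebra fun β =>
    CDGA.mul_self_eq_zero_of_mem_deg_one
      (map_ofNat (algebraMap R (SymDual R P)) 2 ▸ h2.map _) (hφ_deg (1 ⊗ₜ β))
  have hf_d (β : Module.Dual R P) : f (differential R P (dι β)) = A.d (f (dι β)) := by
    rw [← generators_one_tmul, differential_generators, generators_one_tmul, AlgHom.commutes]
    exact (hφ_d (1 ⊗ₜ β)).symm.trans (congrArg A.d (hf β).symm)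
  refine ⟨homOfGenerators f (fun β => (hf β).symm ▸ hφ_deg _) hf_d,
    fancyKoszul_hom_ext fun β => ?_⟩
  calc p.toAlgHom (f (dι β))
    _ = p.toAlgHom (φ (1 ⊗ₜ β)) := congrArg _ (hf β)
    _ = g.toAlgHom (generators (1 ⊗ₜ β)) := hφ_lift _
    _ = g.toAlgHom (dι β : KoszulAlg R P) := congrArg g.toAlgHom (generators_one_tmul β)

lemma isCofibrant_fancyKoszul (h2 : IsUnit (2 : R)) : IsCofibrant (fancyKoszul R P) := by
  refine ⟨fun A B p hp => ⟨fun {f g} sq => ?_⟩⟩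
  obtain ⟨l, hl⟩ := exists_lift_of_trivialFibration h2 hp g
  exact ⟨⟨l, initial.hom_ext _ _, hl⟩⟩

end FancyKoszul

theorem mainTheorem10 (k : Type v) [Field k] [CharZero k] (R : Type u) [CommRing R] [Algebra k R]
    (P : Type u) [AddCommGroup P] [Module R P] [Module.Finite R P] [Module.Projective R P] :
    IsCofibrant (fancyKoszul R P) ∧
    WeakEquivalence (FancyKoszul.augmentation R P) ∧
    Fibration (FancyKoszul.augmentation R P) ∧
    (∀ n : ℕ, 0 < n → ((CDGA.toComplex _).obj (fancyKoszul R P)).ExactAt n) ∧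
    Nonempty (((CDGA.toComplex _).obj (fancyKoszul R P)).homology 0 ≅
      ModuleCat.of (FancyKoszul.SymDual R P) (ZeroSection R P)) := by
  let _ : Algebra ℚ R := Algebra.compHom R (algebraMap ℚ k)
  have h2 : IsUnit (2 : R) :=
    map_ofNat (algebraMap ℚ R) 2 ▸ (IsUnit.mk0 2 two_ne_zero).map (algebraMap ℚ R)
  have hq := FancyKoszul.quasiIso_augmentation R P
  refine ⟨FancyKoszul.isCofibrant_fancyKoszul h2, ⟨hq⟩,
    CDGA.fibration_ofAlgebra (B := ZeroSection R P) _, fun n hn => ?_, ?_⟩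
  · obtain ⟨m, rfl⟩ := Nat.exists_eq_succ_of_ne_zero hn.ne'
    exact (quasiIsoAt_iff_exactAt' ((CDGA.toComplex _).map (FancyKoszul.augmentation R P)) _
      (CDGA.exactAt_ofAlgebra m)).1 inferInstance
  · obtain ⟨e⟩ := CDGA.nonempty_homology_ofAlgebra_iso (FancyKoszul.SymDual R P) (ZeroSection R P)
    exact ⟨isoOfQuasiIsoAt ((CDGA.toComplex _).map (FancyKoszul.augmentation R P)) 0 ≪≫ e⟩
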